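/- Let $G=(V,E)$ be a finite simple graph and let $G(p)$ be a framework in $\mathbb{R}^2$, i.e. $p:V\to\mathbb{R}^2$ is injective, each edge $v_iv_j$ being realised as the segment $p_ip_j$. Edges may cross, but no two different edges overlap, i.e. two different edges have at most one point in common. A self-stress is a family of reals $\omega_{ij}=\omega_{ji}$, with $\omega_{ij}=0$ if $v_iv_j\notin E$, such that $\sum_{j\ne i}\omega_{ij}(p_i-p_j)=0$ for every $i$. Chambers are the connected components of the complement in $\mathbb{R}^2$ of the union of all vertices and edges of $G(p)$. Two different chambers $C_1,C_2$ are neighbours along $p_ip_j$ if a non-empty open sub-segment of $p_ip_j$ lies in the boundaries of both. For a vector $v=(v_1,v_2)$ put $dv=v_1\,dx+v_2\,dy$. A differential lifting of $G(p)$ with respect to a self-stress $\omega$ is a map $l$ from the set of chambers to the constant $1$-forms on $\mathbb{R}^2$ that is zero on the unbounded chamber and satisfies $$l(C_2)-l(C_1)=\operatorname{sign}\bigl(\det(\mathbf n_{12},p_i-p_j)\bigr)\,\omega_{ij}\,d(p_i-p_j)$$ whenever $C_1,C_2$ are neighbours along an edge $p_ip_j$, where $\mathbf n_{12}$ is the unit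 normal vector to $p_i-p_j$ that points from $C_1$ to $C_2$ across the common sub-segment. Then every self-stress $\omega$ of $G(p)$ has exactly one differential lifting $l_{\omega,p}$, and the map $\omega\mapsto l_{\omega,p}$ is a linear bijection from the vector space of self-stresses of $G(p)$ onto the vector space of differential liftings of $G(p)$ (with respect to any of its self-stresses). -/

import Mathlib

open scoped Topology

noncomputable section

/-- The Euclidean plane. -/
abbrev Plane : Type := EuclideanSpace ℝ (Fin 2)

/-- Constant differential one-forms on the plane. -/
abbrev ConstForm : Type := Plane →L[ℝ] ℝ

/-- The constant one-form `d v = v₁ dx + v₂ dy` associated with the vector `v = (v₁, v₂)`. -/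
def dForm (v : Plane) : ConstForm :=
  v 0 • (EuclideanSpace.proj 0 : Plane →L[ℝ] ℝ) + v 1 • (EuclideanSpace.proj 1 : Plane →L[ℝ] ℝ)

/-- The determinant of the two vectors `u`, `v` of the plane. -/
def planeDet (u v : Plane) : ℝ := u 0 * v 1 - u 1 * v 0

variable {V : Type*}

/-- The point set of the framework: all its vertices together with all its (closed) edges. -/
def frameworkSet (G : SimpleGraph V) (p : V → Plane) : Set Plane :=
  Set.range p ∪ ⋃ (i : V) (j : V) (_ : G.Adj i j), segment ℝ (p i) (p j)

/-- No two different edges overlap along a segment of positive length: they have at most one common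
point (a common endpoint, a crossing point, or an endpoint of one of them inside the other). -/
def NoOverlappingEdges (G : SimpleGraph V) (p : V → Plane) : Prop :=
  ∀ i j k l : V, G.Adj i j → G.Adj k l → s(i, j) ≠ s(k, l) →
    (segment ℝ (p i) (p j) ∩ segment ℝ (p k) (p l)).Subsingleton

/-- The space of self-stresses: symmetric real weights, zero on non-edges, which satisfy the
equilibrium condition at every vertex. (The term `j = i` of the sum vanishes.) -/
def selfStresses [Fintype V] (G : SimpleGraph V) (p : V → Plane) : Submodule ℝ (V → V → ℝ) where
  carrier := {ω | (∀ i j, ω i j = ω j i) ∧ (∀ i j, ¬ G.Adj i j → ω i j = 0) ∧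
    ∀ i, ∑ j, ω i j • (p i - p j) = 0}
  zero_mem' := by simp
  add_mem' := by
    rintro a b ⟨ha, ha', ha''⟩ ⟨hb, hb', hb''⟩
    refine ⟨fun i j => ?_, fun i j h => ?_, fun i => ?_⟩
    · simp [ha i j, hb i j]
    · simp [ha' i j h, hb' i j h]
    · simp only [Pi.add_apply, add_smul, Finset.sum_add_distrib, ha'' i, hb'' i, add_zero]
  smul_mem' := by
    rintro c a ⟨ha, ha', ha''⟩
    refine ⟨fun i j => ?_, fun i j h => ?_, fun i => ?_⟩
    · simp [ha i j]
    · simp [ha' i j h]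
    · simp only [Pi.smul_apply, smul_assoc, ← Finset.smul_sum, ha'' i, smul_zero]

/-- A chamber: a connected component of the complement of the framework in the plane. -/
def Chamber (G : SimpleGraph V) (p : V → Plane) : Type :=
  {C : Set Plane // ∃ x ∈ (frameworkSet G p)ᶜ, C = connectedComponentIn (frameworkSet G p)ᶜ x}

/-- Two different chambers `C₁`, `C₂` are neighbours along the edge `p i p j`, sharing the
non-empty open sub-segment `(a, b)` of this edge in their boundaries. -/
def NeighboursAlong (G : SimpleGraph V) (p : V → Plane) (C₁ C₂ : Chamber G p) (i j : V)
    (a b : Plane) : Prop :=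
  C₁ ≠ C₂ ∧ G.Adj i j ∧ a ≠ b ∧ openSegment ℝ a b ⊆ segment ℝ (p i) (p j) ∧
    openSegment ℝ a b ⊆ closure C₁.1 ∩ closure C₂.1

/-- `n` is a unit normal vector to the segment `(a, b)` that points, all along this segment, from
the set `C₁` to the set `C₂`. -/
def IsUnitNormalFromTo (C₁ C₂ : Set Plane) (a b n : Plane) : Prop :=
  ‖n‖ = 1 ∧ inner ℝ n (b - a) = 0 ∧
    ∀ x ∈ openSegment ℝ a b, ∀ᶠ t : ℝ in 𝓝[>] 0, x - t • n ∈ C₁ ∧ x + t • n ∈ C₂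

/-- The map `l` from chambers to constant one-forms is a differential lifting of the framework with
stress `ω`: it satisfies the neighbouring condition for every pair of neighbouring chambers, and it
is zero on the unbounded chamber. -/
def IsDifferentialLifting (G : SimpleGraph V) (p : V → Plane) (ω : V → V → ℝ)
    (l : Chamber G p → ConstForm) : Prop :=
  (∀ (C₁ C₂ : Chamber G p) (i j : V) (a b n : Plane),
    NeighboursAlong G p C₁ C₂ i j a b → IsUnitNormalFromTo C₁.1 C₂.1 a b n →
      l C₂ - l C₁ = (Real.sign (planeDet n (p i - p j)) * ω i j) • dForm (p i - p j)) ∧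
  ∀ C : Chamber G p, ¬ Bornology.IsBounded C.1 → l C = 0

/-- The space of differential liftings of the framework (over all its self-stresses). -/
def differentialLiftings [Fintype V] (G : SimpleGraph V) (p : V → Plane) :
    Submodule ℝ (Chamber G p → ConstForm) where
  carrier := {l | ∃ ω ∈ selfStresses G p, IsDifferentialLifting G p ω l}
  zero_mem' := ⟨0, zero_mem _, by simp [IsDifferentialLifting]⟩
  add_mem' := by
    rintro l m ⟨ω, hω, hl, hl'⟩ ⟨η, hη, hm, hm'⟩
    refine ⟨ω + η, add_mem hω hη, fun C₁ C₂ i j a b n h h' => ?_, fun C hC => ?_⟩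
    · rw [Pi.add_apply, Pi.add_apply, add_sub_add_comm, hl _ _ _ _ _ _ _ h h',
        hm _ _ _ _ _ _ _ h h', Pi.add_apply, Pi.add_apply, mul_add, add_smul]
    · rw [Pi.add_apply, hl' C hC, hm' C hC, add_zero]
  smul_mem' := by
    rintro c l ⟨ω, hω, hl, hl'⟩
    refine ⟨c • ω, Submodule.smul_mem _ c hω, fun C₁ C₂ i j a b n h h' => ?_, fun C hC => ?_⟩
    · have key : c • l C₂ - c • l C₁ = c • (l C₂ - l C₁) := (smul_sub c (l C₂) (l C₁)).symm
      rw [Pi.smul_apply, Pi.smul_apply, key, hl _ _ _ _ _ _ _ h h', smul_smul,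
        Pi.smul_apply, Pi.smul_apply, smul_eq_mul, mul_left_comm]
    · rw [Pi.smul_apply, hl' C hC, smul_zero]

end

/-! Identify the plane with `ℂ` and let the potential at `x` be the sum over ordered pairs of `ω i j
• dForm (p i - p j)`, weighted by the angle `arg ((p i - x) / (p j - x))` and divided by `-4π`.
Evaluated on a vector, it is up to this factor the imaginary part of a sum of `c i j * log ((p i -
x) / (p j - x))` with `c` antisymmetric. Equilibrium says that the rows of `c` sum to zero, so the
complex derivative vanishes and the potential is constant on each chamber
(`stressPotential_eq_of_isPreconnected`). The principal branch is cut exactly along the edges, which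
yields the prescribed jumps (`tendsto_stressPotential_sub`); at infinity every quotient tends to 1,
so the unbounded chamber gets 0. This proves existence. For uniqueness, the difference of two
liftings has no jumps. Vertices and intersections of edges form a finite set whose complement is
connected, so the difference is constant, hence zero (`eq_of_neighbours`). A stress is recovered
from the jumps of its potential, which gives injectivity; surjectivity follows from uniqueness. -/

/-! ### Angles of segments and complex logarithms -/

theorem div_sub_mem_slitPlane {z w u : ℂ} (h : u ∉ segment ℝ z w) :
    (z - u) / (w - u) ∈ Complex.slitPlane := by
  have hw : w - u ≠ 0 := by
    intro h0
    rw [sub_eq_zero] at h0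
    exact h (h0 ▸ right_mem_segment ℝ z w)
  rw [Complex.mem_slitPlane_iff_not_le_zero]
  intro hle
  apply h
  obtain ⟨hre, him⟩ := Complex.le_def.1 hle
  set r : ℝ := -((z - u) / (w - u)).re with hr
  have hr0 : 0 ≤ r := by simpa [hr] using hre
  have hq : (z - u) / (w - u) = -(r : ℂ) := by
    apply Complex.ext
    · simp [hr]
    · simpa using him
  rw [div_eq_iff hw] at hq
  have h1 : (0 : ℝ) < 1 + r := by linarith
  have h1c : (1 + (r : ℂ)) ≠ 0 := by exact_mod_cast h1.ne'
  -- Solving `z - u = -r (w - u)` gives `u = (z + r w) / (1 + r)`.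
  refine ⟨1 / (1 + r), r / (1 + r), by positivity, by positivity, by field_simp, ?_⟩
  simp only [Complex.real_smul]
  push_cast
  field_simp
  linear_combination hq

/-- A combination of logarithms of cross-ratios with balanced coefficients has zero derivative, so
it is constant on connected open sets. -/
theorem sum_arg_eq_of_isPreconnected {V : Type*} [Fintype V] (z : V → ℂ) (c : V → V → ℝ)
    (hanti : ∀ i j, c j i = -c i j) (hsum : ∀ i, ∑ j, c i j = 0) {U : Set ℂ} (hU : IsOpen U)
    (hU' : IsPreconnected U) (hz : ∀ i, z i ∉ U)
    (hseg : ∀ i j, c i j ≠ 0 → Disjoint U (segment ℝ (z i) (z j))) {x y : ℂ} (hx : x ∈ U)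
    (hy : y ∈ U) :
    ∑ i, ∑ j, c i j * Complex.arg ((z i - x) / (z j - x)) =
      ∑ i, ∑ j, c i j * Complex.arg ((z i - y) / (z j - y)) := by
  set F : ℂ → ℂ := fun u => ∑ i, ∑ j, (c i j : ℂ) * Complex.log ((z i - u) / (z j - u)) with hF
  have hder : ∀ u ∈ U, HasDerivAt F 0 u := by
    intro u hu
    have hne : ∀ i, z i - u ≠ 0 := fun i h0 => hz i (by rwa [sub_eq_zero.1 h0])
    have hterm : ∀ i j, HasDerivAt (fun u => (c i j : ℂ) * Complex.log ((z i - u) / (z j - u)))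
        ((c i j : ℂ) * ((z j - u)⁻¹ - (z i - u)⁻¹)) u := by
      intro i j
      -- A segment with coefficient 0 may meet `U`, where the logarithm need not be differentiable;
      -- its term is identically zero.
      by_cases h0 : c i j = 0
      · simpa [h0] using hasDerivAt_const u (0 : ℂ)
      have hslit : (z i - u) / (z j - u) ∈ Complex.slitPlane :=
        div_sub_mem_slitPlane (Set.disjoint_left.1 (hseg i j h0) hu)
      have hd (k : V) : HasDerivAt (fun u => z k - u) (-1) u := by
        simpa using (hasDerivAt_id u).const_sub (z k)
      refine ((((hd i).fun_div (hd j) (hne j)).clog hslit).const_mul (c i j : ℂ)).congr_deriv ?_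
      have := hne i
      have := hne j
      field_simp
      ring
    have hs : HasDerivAt F (∑ i, ∑ j, (c i j : ℂ) * ((z j - u)⁻¹ - (z i - u)⁻¹)) u :=
      HasDerivAt.fun_sum fun i _ => HasDerivAt.fun_sum fun j _ => hterm i j
    have hrow : ∀ i, ∑ j, (c i j : ℂ) = 0 := fun i => by exact_mod_cast hsum i
    have hcol : ∀ j, ∑ i, (c i j : ℂ) = 0 := fun j => by
      have : ∀ i, (c i j : ℂ) = -(c j i : ℂ) := fun i => by rw [hanti j i]; push_cast; rfl
      simp only [this, Finset.sum_neg_distrib, hrow, neg_zero]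
    convert hs using 1
    simp only [mul_sub, Finset.sum_sub_distrib]
    rw [Finset.sum_comm]
    simp only [← Finset.sum_mul, hrow, hcol, zero_mul, Finset.sum_const_zero, sub_self]
  have hconst : F x = F y := hU.is_const_of_deriv_eq_zero hU'
    (fun u hu => (hder u hu).differentiableAt.differentiableWithinAt)
    (fun u hu => (hder u hu).deriv) hx hy
  have him : ∀ u, (F u).im = ∑ i, ∑ j, c i j * Complex.arg ((z i - u) / (z j - u)) := fun u => by
    simp [hF, Complex.im_sum, Complex.log_im]
  rw [← him, ← him, hconst]

/-- The quotient equals `1 + (z - w) / (w - u)`, and `arg` is continuous at 1 with value 0. -/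
theorem tendsto_arg_div_sub_cobounded (z w : ℂ) :
    Filter.Tendsto (fun u => Complex.arg ((z - u) / (w - u))) (Bornology.cobounded ℂ) (𝓝 0) := by
  have h1 : Filter.Tendsto (fun u : ℂ => w - u) (Bornology.cobounded ℂ)
      (Bornology.cobounded ℂ) := tendsto_const_sub_cobounded w
  have h2 : Filter.Tendsto (fun u : ℂ => 1 + (z - w) * (w - u)⁻¹) (Bornology.cobounded ℂ)
      (𝓝 1) := by
    simpa using ((Filter.tendsto_inv₀_cobounded.comp h1).const_mul (z - w)).const_add 1
  have h3 : Filter.Tendsto (fun u : ℂ => (z - u) / (w - u)) (Bornology.cobounded ℂ) (𝓝 1) := by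
    refine h2.congr' ?_
    filter_upwards [h1.eventually (Bornology.eventually_ne_cobounded (0 : ℂ))] with u hu
    field_simp
    ring
  simpa [Function.comp_def] using
    (Complex.continuousAt_arg Complex.one_mem_slitPlane).tendsto.comp h3

/-- The argument of `(z - x) / (w - x)` as `x` approaches a point of the open segment `(z, w)` from
one of its sides. -/
theorem tendsto_arg_div_sub_segment {z w x m : ℂ} (hx : x ∈ segment ℝ z w) (hxz : x ≠ z)
    (hxw : x ≠ w) (hm : m.re * (z - w).im - m.im * (z - w).re ≠ 0) :
    Filter.Tendsto (fun t : ℝ => Complex.arg ((z - (x + t • m)) / (w - (x + t • m)))) (𝓝[>] 0)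
      (𝓝 (-(Real.sign (m.re * (z - w).im - m.im * (z - w).re) * Real.pi))) := by
  set d := m.re * (z - w).im - m.im * (z - w).re with hd
  obtain ⟨a, b, ha, hb, hab, rfl⟩ := hx
  have hb' : b = 1 - a := by linarith
  subst hb'
  have ha0 : a ≠ 0 := by rintro rfl; simp at hxw
  have ha1 : 1 - a ≠ 0 := by
    intro h
    have : a = 1 := by linarith
    subst this; simp at hxz
  set x := a • z + (1 - a) • w with hxdef
  have hzx : z - x = (1 - a) • (z - w) := by rw [hxdef]; module
  have hwx : w - x = (-a) • (z - w) := by rw [hxdef]; module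
  have hzw : z - w ≠ 0 := by
    intro h; apply hm; rw [hd, h]; simp
  have hwx0 : w - x ≠ 0 := by rw [hwx]; simp [ha0, hzw]
  have hq : (z - x) / (w - x) = ((-((1 - a) / a) : ℝ) : ℂ) := by
    rw [div_eq_iff hwx0, hzx, hwx]
    simp only [Complex.real_smul]
    push_cast
    have : (a : ℂ) ≠ 0 := by exact_mod_cast ha0
    field_simp
  have hpos : 0 < (1 - a) / a := div_pos (lt_of_le_of_ne hb ha1.symm) (lt_of_le_of_ne ha ha0.symm)
  have hre : ((z - x) / (w - x)).re < 0 := by rw [hq, Complex.ofReal_re]; linarith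
  have him : ((z - x) / (w - x)).im = 0 := by rw [hq, Complex.ofReal_im]
  have hcont : ContinuousAt (fun t : ℝ => (z - (x + t • m)) / (w - (x + t • m))) 0 := by
    apply ContinuousAt.div
    · fun_prop
    · fun_prop
    · simpa using hwx0
  have hlim : Filter.Tendsto (fun t : ℝ => (z - (x + t • m)) / (w - (x + t • m))) (𝓝[>] 0)
      (𝓝 ((z - x) / (w - x))) := by
    have := hcont.tendsto.mono_left (nhdsWithin_le_nhds (s := Set.Ioi 0))
    simpa using this
  -- On the cut itself `arg` is `π`, so the limit `-π` needs a strictly negative imaginary part,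
  -- hence a nonzero denominator.
  have hden : ∀ᶠ t : ℝ in 𝓝[>] 0, w - (x + t • m) ≠ 0 := by
    have hc : ContinuousAt (fun t : ℝ => w - (x + t • m)) 0 := by fun_prop
    exact (hc.eventually_ne (by simpa using hwx0)).filter_mono nhdsWithin_le_nhds
  -- For `t > 0` the sign of `d` alone decides from which side the quotient approaches the cut.
  have himt : ∀ t : ℝ, ((z - (x + t • m)) / (w - (x + t • m))).im =
      -(t * d) / Complex.normSq (w - (x + t • m)) := by
    intro t
    have e1 : z - (x + t • m) = (1 - a) • (z - w) - t • m := by rw [← hzx]; ring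
    have e2 : w - (x + t • m) = (-a) • (z - w) - t • m := by rw [← hwx]; ring
    rw [Complex.div_im, ← sub_div]
    congr 1
    rw [e1, e2, hd]
    simp only [Complex.sub_im, Complex.sub_re, Complex.smul_im, Complex.smul_re, smul_eq_mul]
    ring
  rcases lt_or_gt_of_ne hm with h | h
  · rw [Real.sign_of_neg h]
    have := (Complex.tendsto_arg_nhdsWithin_im_nonneg_of_re_neg_of_im_zero hre him).comp
      (tendsto_nhdsWithin_iff.2 ⟨hlim, by
        filter_upwards [self_mem_nhdsWithin] with t ht
        have : 0 < t := ht
        change 0 ≤ Complex.im _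
        rw [himt]
        exact div_nonneg (by nlinarith) (Complex.normSq_nonneg _)⟩)
    simpa [Function.comp_def] using this
  · rw [Real.sign_of_pos h]
    have := (Complex.tendsto_arg_nhdsWithin_im_neg_of_re_neg_of_im_zero hre him).comp
      (tendsto_nhdsWithin_iff.2 ⟨hlim, by
        filter_upwards [self_mem_nhdsWithin, hden] with t ht ht'
        have : 0 < t := ht
        change Complex.im _ < 0
        rw [himt]
        exact div_neg_of_neg_of_pos (by nlinarith [mul_pos this h]) (Complex.normSq_pos.2 ht')⟩)
    simpa [Function.comp_def] using this

/-! ### The potential of a stress and its jumps -/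

section

/-- The isometry `(x, y) ↦ x + y i` from the plane onto the complex numbers. -/
noncomputable def planeToComplex : Plane ≃ₗᵢ[ℝ] ℂ := Complex.orthonormalBasisOneI.repr.symm

theorem planeToComplex_re (x : Plane) : (planeToComplex x).re = x 0 := by
  simp [planeToComplex, Complex.orthonormalBasisOneI_repr_symm_apply]

theorem planeToComplex_im (x : Plane) : (planeToComplex x).im = x 1 := by
  simp [planeToComplex, Complex.orthonormalBasisOneI_repr_symm_apply]

theorem planeToComplex_mem_segment {x a b : Plane} :
    planeToComplex x ∈ segment ℝ (planeToComplex a) (planeToComplex b) ↔ x ∈ segment ℝ a b := by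
  have := image_segment ℝ (planeToComplex.toLinearEquiv : Plane →ₗ[ℝ] ℂ).toAffineMap a b
  simp only [LinearMap.coe_toAffineMap, LinearEquiv.coe_coe, LinearIsometryEquiv.coe_toLinearEquiv]
    at this
  rw [← this, planeToComplex.injective.mem_set_image]

theorem dForm_apply (v w : Plane) : dForm v w = v 0 * w 0 + v 1 * w 1 := by
  simp [dForm]

theorem dForm_self_ne_zero {v : Plane} (hv : v ≠ 0) : dForm v v ≠ 0 := by
  rw [dForm_apply]
  intro h
  apply hv
  ext k
  fin_cases k
  · simp; nlinarith [sq_nonneg (v 0), sq_nonneg (v 1)]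
  · simp; nlinarith [sq_nonneg (v 0), sq_nonneg (v 1)]

theorem dForm_sub_comm (v w : Plane) : dForm (v - w) = -dForm (w - v) := by
  ext u
  simp [dForm_apply]
  ring

theorem planeDet_sub_comm (n v w : Plane) : planeDet n (v - w) = -planeDet n (w - v) := by
  simp [planeDet]
  ring

variable {V : Type*}

theorem subset_frameworkSet {G : SimpleGraph V} (p : V → Plane) {i j : V} (h : G.Adj i j) :
    segment ℝ (p i) (p j) ⊆ frameworkSet G p := fun _ hx =>
  Or.inr (Set.mem_iUnion.2 ⟨i, Set.mem_iUnion.2 ⟨j, Set.mem_iUnion.2 ⟨h, hx⟩⟩⟩)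

theorem vertex_mem_frameworkSet (G : SimpleGraph V) (p : V → Plane) (i : V) :
    p i ∈ frameworkSet G p := Or.inl ⟨i, rfl⟩

/-- The vertices of the framework and the common points of different edges. -/
def singularSet (G : SimpleGraph V) (p : V → Plane) : Set Plane :=
  Set.range p ∪ ⋃ (i : V) (j : V) (k : V) (l : V)
    (_ : G.Adj i j ∧ G.Adj k l ∧ s(i, j) ≠ s(k, l)),
    segment ℝ (p i) (p j) ∩ segment ℝ (p k) (p l)

theorem finite_singularSet [Finite V] {G : SimpleGraph V} {p : V → Plane}
    (hov : NoOverlappingEdges G p) : (singularSet G p).Finite :=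
  (Set.finite_range p).union <| Set.finite_iUnion fun i => Set.finite_iUnion fun j =>
    Set.finite_iUnion fun k => Set.finite_iUnion fun l => Set.finite_iUnion fun h =>
      (hov i j k l h.1 h.2.1 h.2.2).finite

theorem ne_vertex_of_notMem_singularSet {G : SimpleGraph V} {p : V → Plane} {x : Plane}
    (hx : x ∉ singularSet G p) (i : V) : x ≠ p i := fun h => hx (Or.inl ⟨i, h.symm⟩)

theorem notMem_segment_of_notMem_singularSet {G : SimpleGraph V} {p : V → Plane} {x : Plane}
    (hx : x ∉ singularSet G p) {i j k l : V} (hij : G.Adj i j) (hxij : x ∈ segment ℝ (p i) (p j))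
    (hkl : G.Adj k l) (hne : s(i, j) ≠ s(k, l)) : x ∉ segment ℝ (p k) (p l) := fun h =>
  hx <| Or.inr <| by
    simp only [Set.mem_iUnion]
    exact ⟨i, j, k, l, ⟨hij, hkl, hne⟩, hxij, h⟩

variable [Fintype V]

/-- The form-valued function on the plane which is constant on the chambers and jumps across the
edges according to the stress `ω`: the sum of the forms `ω i j • d (p i - p j)` weighted with the
angles under which the edges are seen. -/
noncomputable def stressPotential (ω : V → V → ℝ) (p : V → Plane) (x : Plane) : ConstForm :=
  -- Each edge occurs in the double sum as `(i, j)` and as `(j, i)`, and each occurrence jumps by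
  -- `2π` in absolute value; the factor normalises the total and its sign.
  (-(4 * Real.pi)⁻¹) • ∑ i, ∑ j, (ω i j * Complex.arg
    ((planeToComplex (p i) - planeToComplex x) / (planeToComplex (p j) - planeToComplex x))) •
      dForm (p i - p j)

theorem stressPotential_add (ω η : V → V → ℝ) (p : V → Plane) (x : Plane) :
    stressPotential (ω + η) p x = stressPotential ω p x + stressPotential η p x := by
  simp only [stressPotential, Pi.add_apply, add_mul, add_smul, Finset.sum_add_distrib, smul_add]

theorem stressPotential_smul (c : ℝ) (ω : V → V → ℝ) (p : V → Plane) (x : Plane) :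
    stressPotential (c • ω) p x = c • stressPotential ω p x := by
  simp only [stressPotential, Pi.smul_apply, smul_eq_mul, mul_assoc, mul_smul,
    ← Finset.smul_sum]
  rw [smul_comm]

theorem stressPotential_eq_of_isPreconnected {G : SimpleGraph V} {p : V → Plane}
    {ω : V → V → ℝ} (hω : ω ∈ selfStresses G p) {U : Set Plane} (hU : IsOpen U)
    (hU' : IsPreconnected U) (hUF : U ⊆ (frameworkSet G p)ᶜ) {x y : Plane} (hx : x ∈ U)
    (hy : y ∈ U) : stressPotential ω p x = stressPotential ω p y := by
  obtain ⟨hsymm, hadj, heq⟩ := hω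
  ext w
  have key := sum_arg_eq_of_isPreconnected (fun i => planeToComplex (p i))
    (fun i j => ω i j * dForm (p i - p j) w) (U := planeToComplex '' U)
    (x := planeToComplex x) (y := planeToComplex y)
    (fun i j => by rw [hsymm i j, dForm_sub_comm]; simp)
    -- Row sums vanish: pair the two coordinates of the equilibrium condition with `w`.
    (fun i => by
      have h0 := congrArg (fun v : Plane => v 0) (heq i)
      have h1 := congrArg (fun v : Plane => v 1) (heq i)
      simp only [WithLp.ofLp_sum, WithLp.ofLp_smul, Finset.sum_apply, Pi.smul_apply, smul_eq_mul,
        WithLp.ofLp_zero, Pi.zero_apply] at h0 h1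
      simp only [dForm_apply, mul_add, ← mul_assoc, Finset.sum_add_distrib, ← Finset.sum_mul]
      rw [h0, h1]
      simp)
    (planeToComplex.toHomeomorph.isOpenMap U hU)
    (hU'.image _ planeToComplex.continuous.continuousOn)
    (fun i => by
      rw [planeToComplex.injective.mem_set_image]
      exact fun h => hUF h (vertex_mem_frameworkSet G p i))
    (fun i j hij => by
      rw [Set.disjoint_left]
      rintro _ ⟨u, hu, rfl⟩ h
      rw [planeToComplex_mem_segment] at h
      refine hUF hu (subset_frameworkSet p ?_ h)
      by_contra hna
      exact hij (by simp [hadj i j hna]))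
    (Set.mem_image_of_mem _ hx) (Set.mem_image_of_mem _ hy)
  simp only [stressPotential, smul_apply, sum_apply,
    smul_eq_mul]
  congr 1
  simpa only [mul_right_comm] using key

theorem tendsto_stressPotential_cobounded (ω : V → V → ℝ) (p : V → Plane) :
    Filter.Tendsto (stressPotential ω p) (Bornology.cobounded Plane) (𝓝 0) := by
  have hc : Filter.Tendsto planeToComplex (Bornology.cobounded Plane) (Bornology.cobounded ℂ) :=
    planeToComplex.antilipschitz.tendsto_cobounded
  have : Filter.Tendsto (stressPotential ω p) (Bornology.cobounded Plane)
      (𝓝 ((-(4 * Real.pi)⁻¹) • ∑ i, ∑ j, (ω i j * 0) • dForm (p i - p j))) :=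
    (tendsto_finsetSum _ fun i _ => tendsto_finsetSum _ fun j _ =>
      (((tendsto_arg_div_sub_cobounded _ _).comp hc).const_mul _).smul_const _).const_smul _
  simpa using this

/-- The angle under which a segment is seen does not jump at points off the segment. -/
theorem tendsto_arg_sub_arg_of_notMem_segment {a b x : Plane} (n : Plane)
    (hx : x ∉ segment ℝ a b) :
    Filter.Tendsto (fun t : ℝ => Complex.arg ((planeToComplex a - planeToComplex (x + t • n)) /
        (planeToComplex b - planeToComplex (x + t • n))) -
      Complex.arg ((planeToComplex a - planeToComplex (x - t • n)) /
        (planeToComplex b - planeToComplex (x - t • n)))) (𝓝[>] 0) (𝓝 0) := by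
  have hslit := div_sub_mem_slitPlane (mt planeToComplex_mem_segment.1 hx)
  have hb : planeToComplex b - planeToComplex x ≠ 0 := by
    intro h
    rw [sub_eq_zero, planeToComplex.injective.eq_iff] at h
    exact hx (h ▸ right_mem_segment ℝ a b)
  have h1 : ContinuousAt (fun u : Plane => Complex.arg ((planeToComplex a - planeToComplex u) /
      (planeToComplex b - planeToComplex u))) x := by
    refine ContinuousAt.comp (g := Complex.arg) (Complex.continuousAt_arg hslit) ?_
    have := planeToComplex.continuous
    exact ContinuousAt.div (by fun_prop) (by fun_prop) hb
  have h2 : ∀ m : Plane, Filter.Tendsto (fun t : ℝ => x + t • m) (𝓝[>] 0) (𝓝 x) := fun m => by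
    have : ContinuousAt (fun t : ℝ => x + t • m) 0 := by fun_prop
    simpa using this.tendsto.mono_left (nhdsWithin_le_nhds (s := Set.Ioi 0))
  have := (h1.tendsto.comp (h2 n)).sub (h1.tendsto.comp (h2 (-n)))
  simpa [Function.comp_def, ← sub_eq_add_neg] using this

/-- The angle under which a segment is seen jumps by `2π` across the segment. -/
theorem tendsto_arg_sub_arg_of_mem_segment {a b x n : Plane} (hx : x ∈ segment ℝ a b)
    (hxa : x ≠ a) (hxb : x ≠ b) (hn : planeDet n (a - b) ≠ 0) :
    Filter.Tendsto (fun t : ℝ => Complex.arg ((planeToComplex a - planeToComplex (x + t • n)) /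
        (planeToComplex b - planeToComplex (x + t • n))) -
      Complex.arg ((planeToComplex a - planeToComplex (x - t • n)) /
        (planeToComplex b - planeToComplex (x - t • n)))) (𝓝[>] 0)
      (𝓝 (-(2 * Real.pi) * Real.sign (planeDet n (a - b)))) := by
  have hdet : ∀ m : Plane, (planeToComplex m).re * (planeToComplex a - planeToComplex b).im -
      (planeToComplex m).im * (planeToComplex a - planeToComplex b).re = planeDet m (a - b) := by
    intro m
    rw [← map_sub]
    simp only [planeToComplex_re, planeToComplex_im, planeDet]
  have hneg : planeDet (-n) (a - b) = -planeDet n (a - b) := by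
    simp [planeDet]; ring
  have key : ∀ m : Plane, planeDet m (a - b) ≠ 0 → Filter.Tendsto (fun t : ℝ => Complex.arg
      ((planeToComplex a - planeToComplex (x + t • m)) /
        (planeToComplex b - planeToComplex (x + t • m)))) (𝓝[>] 0)
      (𝓝 (-(Real.sign (planeDet m (a - b)) * Real.pi))) := by
    intro m hm
    have := tendsto_arg_div_sub_segment (m := planeToComplex m)
      (planeToComplex_mem_segment.2 hx) (planeToComplex.injective.ne hxa)
      (planeToComplex.injective.ne hxb) (by rwa [hdet])
    rw [hdet] at this
    simpa only [map_add, map_smul] using this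
  have := (key n hn).sub (key (-n) (by rwa [hneg, neg_ne_zero]))
  rw [hneg, Real.sign_neg] at this
  convert this using 2
  · simp [sub_eq_add_neg]
  · ring

/-- The jump of the potential across an edge. -/
theorem tendsto_stressPotential_sub {G : SimpleGraph V} {p : V → Plane} {ω : V → V → ℝ}
    (hω : ω ∈ selfStresses G p) {i j : V} (hij : G.Adj i j) {x n : Plane}
    (hx : x ∈ segment ℝ (p i) (p j)) (hxS : x ∉ singularSet G p)
    (hn : planeDet n (p i - p j) ≠ 0) :
    Filter.Tendsto (fun t : ℝ => stressPotential ω p (x + t • n) - stressPotential ω p (x - t • n))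
      (𝓝[>] 0) (𝓝 ((Real.sign (planeDet n (p i - p j)) * ω i j) • dForm (p i - p j))) := by
  classical
  obtain ⟨hsymm, hadj, -⟩ := hω
  set A : ConstForm := (Real.sign (planeDet n (p i - p j)) * ω i j) • dForm (p i - p j) with hA
  have hne := ne_vertex_of_notMem_singularSet hxS
  have hterm : ∀ k l, Filter.Tendsto (fun t : ℝ =>
      (ω k l * (Complex.arg ((planeToComplex (p k) - planeToComplex (x + t • n)) /
          (planeToComplex (p l) - planeToComplex (x + t • n))) -
        Complex.arg ((planeToComplex (p k) - planeToComplex (x - t • n)) /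
          (planeToComplex (p l) - planeToComplex (x - t • n))))) • dForm (p k - p l)) (𝓝[>] 0)
      (𝓝 ((if k = i ∧ l = j then -(2 * Real.pi) • A else 0) +
        if k = j ∧ l = i then -(2 * Real.pi) • A else 0)) := by
    intro k l
    by_cases h1 : k = i ∧ l = j
    · obtain ⟨rfl, rfl⟩ := h1
      have h2 : ¬ (k = l ∧ l = k) := fun h => hij.ne h.1
      have := ((tendsto_arg_sub_arg_of_mem_segment hx (hne k) (hne l) hn).const_mul
        (ω k l)).smul_const (dForm (p k - p l))
      rw [if_pos ⟨rfl, rfl⟩, if_neg h2, add_zero]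
      convert this using 2
      rw [hA, smul_smul]
      ring_nf
    -- Reversing the edge changes the sign of both the determinant and the form, so both
    -- orientations contribute the same jump.
    by_cases h2 : k = j ∧ l = i
    · obtain ⟨rfl, rfl⟩ := h2
      have h0 := planeDet_sub_comm n (p k) (p l)
      have := ((tendsto_arg_sub_arg_of_mem_segment (segment_symm ℝ (p l) (p k) ▸ hx) (hne k)
        (hne l) (by rwa [h0, neg_ne_zero])).const_mul (ω k l)).smul_const (dForm (p k - p l))
      rw [if_neg h1, if_pos ⟨rfl, rfl⟩, zero_add]
      convert this using 2
      rw [hA, smul_smul, h0, dForm_sub_comm (p k) (p l), Real.sign_neg, hsymm k l, smul_neg,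
        ← neg_smul]
      ring_nf
    · rw [if_neg h1, if_neg h2, add_zero]
      by_cases hkl : G.Adj k l
      · have hs : s(i, j) ≠ s(k, l) := by
          rw [Ne, Sym2.eq_iff]
          rintro (⟨rfl, rfl⟩ | ⟨rfl, rfl⟩)
          · exact h1 ⟨rfl, rfl⟩
          · exact h2 ⟨rfl, rfl⟩
        simpa using ((tendsto_arg_sub_arg_of_notMem_segment n
          (notMem_segment_of_notMem_singularSet hxS hij hx hkl hs)).const_mul
            (ω k l)).smul_const (dForm (p k - p l))
      · simp [hadj k l hkl]
  have hsum := (tendsto_finsetSum Finset.univ fun k _ => tendsto_finsetSum Finset.univ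
    fun l _ => hterm k l).const_smul (-(4 * Real.pi)⁻¹)
  convert hsum using 2
  · ext w
    simp only [stressPotential, sub_apply, smul_apply, sum_apply, smul_eq_mul, mul_sub, sub_mul,
      Finset.sum_sub_distrib]
  · simp only [Finset.sum_add_distrib, ite_and, Finset.sum_ite_eq', Finset.sum_const_zero,
      Finset.mem_univ, if_true, Finset.sum_ite_irrel]
    rw [← two_smul ℝ, smul_smul, smul_smul]
    have : -(4 * Real.pi)⁻¹ * 2 * -(2 * Real.pi) = 1 := by
      field_simp
      norm_num
    rw [this, one_smul]

end

/-! ### Local geometry at a non-singular point of an edge -/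

section

variable {V : Type*}

theorem isCompact_segment_plane (a b : Plane) : IsCompact (segment ℝ a b) := by
  rw [segment_eq_image_lineMap]
  exact isCompact_Icc.image AffineMap.lineMap_continuous

theorem isCompact_frameworkSet [Finite V] (G : SimpleGraph V) (p : V → Plane) :
    IsCompact (frameworkSet G p) :=
  (Set.finite_range p).isCompact.union <| isCompact_iUnion fun i => isCompact_iUnion fun j =>
    isCompact_iUnion fun _ => isCompact_segment_plane (p i) (p j)

theorem exists_eq_smul_of_planeDet_eq_zero {u v : Plane} (hv : v ≠ 0) (h : planeDet u v = 0) :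
    ∃ s : ℝ, u = s • v := by
  have h0 := dForm_self_ne_zero hv
  rw [dForm_apply] at h0
  rw [planeDet] at h
  refine ⟨(u 0 * v 0 + u 1 * v 1) / (v 0 * v 0 + v 1 * v 1), ?_⟩
  ext k
  rw [PiLp.smul_apply, smul_eq_mul, div_mul_eq_mul_div, eq_div_iff h0]
  fin_cases k
  · simp only [Fin.zero_eta, Fin.isValue]
    linear_combination v 1 * h
  · simp only [Fin.mk_one, Fin.isValue]
    linear_combination -v 0 * h

theorem isLinearMap_planeDet (v : Plane) : IsLinearMap ℝ fun u => planeDet u v where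
  map_add u w := by simp [planeDet]; ring
  map_smul c u := by simp [planeDet]; ring

/-- Near a non-singular point of an edge, the framework coincides with this edge. -/
theorem exists_ball_inter_frameworkSet_subset [Finite V] {G : SimpleGraph V} {p : V → Plane}
    {i j : V} (hij : G.Adj i j) {x : Plane} (hx : x ∈ segment ℝ (p i) (p j))
    (hxS : x ∉ singularSet G p) :
    ∃ r > 0, Metric.ball x r ∩ frameworkSet G p ⊆ segment ℝ (p i) (p j) := by
  -- `K` consists of the vertices and all other edges: a closed set that misses `x`.
  set K : Set Plane := Set.range p ∪ ⋃ (k : V) (l : V) (_ : G.Adj k l ∧ s(i, j) ≠ s(k, l)),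
    segment ℝ (p k) (p l) with hK
  have hKc : IsClosed K :=
    ((Set.finite_range p).isCompact.union <| isCompact_iUnion fun k => isCompact_iUnion fun l =>
      isCompact_iUnion fun _ => isCompact_segment_plane (p k) (p l)).isClosed
  have hxK : x ∉ K := by
    rintro (⟨k, rfl⟩ | h)
    · exact hxS (Or.inl ⟨k, rfl⟩)
    · simp only [Set.mem_iUnion] at h
      obtain ⟨k, l, ⟨hkl, hne⟩, h⟩ := h
      exact notMem_segment_of_notMem_singularSet hxS hij hx hkl hne h
  obtain ⟨r, hr, hball⟩ := Metric.isOpen_iff.1 hKc.isOpen_compl x hxK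
  refine ⟨r, hr, ?_⟩
  rintro y ⟨hy, hyF⟩
  have hyK := hball hy
  rcases hyF with h | h
  · exact (hyK (Or.inl h)).elim
  · simp only [Set.mem_iUnion] at h
    obtain ⟨k, l, hkl, h⟩ := h
    by_cases hne : s(i, j) = s(k, l)
    · rcases Sym2.eq_iff.1 hne with ⟨rfl, rfl⟩ | ⟨rfl, rfl⟩
      · exact h
      · rwa [segment_symm]
    · refine (hyK (Or.inr ?_)).elim
      simp only [Set.mem_iUnion]
      exact ⟨k, l, ⟨hkl, hne⟩, h⟩

theorem planeDet_sub_of_mem_segment {a b x y : Plane} (hx : x ∈ segment ℝ a b)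
    (hy : y ∈ segment ℝ a b) : planeDet (y - x) (a - b) = 0 := by
  obtain ⟨s, t, -, -, hst, rfl⟩ := hx
  obtain ⟨s', t', -, -, hst', rfl⟩ := hy
  obtain rfl : t = 1 - s := by linarith
  obtain rfl : t' = 1 - s' := by linarith
  simp [planeDet]
  ring

/-- Around a non-singular point of an edge, the two sides of the edge lie outside the framework. -/
theorem exists_sides [Finite V] {G : SimpleGraph V} {p : V → Plane} (hp : Function.Injective p)
    {i j : V} (hij : G.Adj i j) {x : Plane} (hx : x ∈ segment ℝ (p i) (p j))
    (hxS : x ∉ singularSet G p) :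
    ∃ (a b n : Plane) (H₁ H₂ : Set Plane), a ≠ b ∧ openSegment ℝ a b ⊆ segment ℝ (p i) (p j) ∧
      x ∈ openSegment ℝ a b ∧ planeDet n (p i - p j) ≠ 0 ∧ IsUnitNormalFromTo H₁ H₂ a b n ∧
      Convex ℝ H₁ ∧ Convex ℝ H₂ ∧ H₁ ⊆ (frameworkSet G p)ᶜ ∧ H₂ ⊆ (frameworkSet G p)ᶜ ∧
      ∀ᶠ y in 𝓝 x, y ∈ frameworkSet G p ∨ y ∈ H₁ ∨ y ∈ H₂ := by
  obtain ⟨r₀, hr₀, hball⟩ := exists_ball_inter_frameworkSet_subset hij hx hxS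
  set v := p i - p j with hv
  have hv0 : v ≠ 0 := sub_ne_zero.2 (hp.ne hij.ne)
  have hvn : 0 < ‖v‖ := norm_pos_iff.2 hv0
  obtain ⟨τ, σ, hτ, hσ, hτσ, hxe⟩ := id hx
  have hσ' : σ = 1 - τ := by linarith
  subst hσ'
  have hτ0 : 0 < τ := lt_of_le_of_ne hτ fun h => by
    subst h
    exact ne_vertex_of_notMem_singularSet hxS j (by simpa using hxe.symm)
  have hτ1 : 0 < 1 - τ := lt_of_le_of_ne hσ fun h => by
    obtain rfl : τ = 1 := by linarith
    exact ne_vertex_of_notMem_singularSet hxS i (by simpa using hxe.symm)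
  -- The distances from `x` to `p j` and `p i` are `τ * ‖v‖` and `(1 - τ) * ‖v‖`, so inside the ball
  -- the line of the edge stays on the edge.
  obtain ⟨r, hr, hrr₀, hrτ, hrσ⟩ : ∃ r > 0, r ≤ r₀ ∧ r ≤ τ * ‖v‖ ∧ r ≤ (1 - τ) * ‖v‖ :=
    ⟨min r₀ (min (τ * ‖v‖) ((1 - τ) * ‖v‖)), by positivity, min_le_left _ _,
      (min_le_right _ _).trans (min_le_left _ _), (min_le_right _ _).trans (min_le_right _ _)⟩
  have hline : ∀ s : ℝ, |s| * ‖v‖ < r → x + s • v ∈ segment ℝ (p i) (p j) := by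
    intro s hs
    have h1 : |s| < τ := lt_of_mul_lt_mul_right (hs.trans_le hrτ) hvn.le
    have h2 : |s| < 1 - τ := lt_of_mul_lt_mul_right (hs.trans_le hrσ) hvn.le
    rw [abs_lt] at h1 h2
    refine ⟨τ + s, 1 - (τ + s), by linarith, by linarith, by ring, ?_⟩
    rw [← hxe, hv]
    module
  have hlin := isLinearMap_planeDet v
  -- Open half-discs; `ε = 1` and `ε = -1` select the two sides of the edge.
  set H : ℝ → Set Plane := fun ε => Metric.ball x r ∩ {y | 0 < ε * planeDet (y - x) v} with hH
  have hconv : ∀ ε, Convex ℝ (H ε) := by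
    intro ε
    refine (convex_ball x r).inter ?_
    have : {y | 0 < ε * planeDet (y - x) v} = {y | ε * planeDet x v < ε * planeDet y v} := by
      ext y
      change 0 < ε * planeDet (y - x) v ↔ ε * planeDet x v < ε * planeDet y v
      rw [hlin.map_sub, mul_sub, sub_pos]
    rw [this]
    exact convex_halfSpace_gt ⟨fun a b => by rw [hlin.map_add]; ring,
      fun c a => by rw [hlin.map_smul]; simp; ring⟩ _
  have hcompl : ∀ ε, H ε ⊆ (frameworkSet G p)ᶜ := by
    rintro ε y ⟨hy, hy'⟩ hyF
    have := planeDet_sub_of_mem_segment hx (hball ⟨Metric.ball_subset_ball hrr₀ hy, hyF⟩)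
    change 0 < ε * planeDet (y - x) v at hy'
    rw [this, mul_zero] at hy'
    exact lt_irrefl _ hy'
  -- `v` turned by a right angle and normalised, with positive determinant against `v`, so that it
  -- points into `H 1`.
  set n : Plane := ‖v‖⁻¹ • !₂[v 1, -v 0] with hn
  have hnorm : ‖v‖ ^ 2 = v 0 ^ 2 + v 1 ^ 2 := by
    rw [EuclideanSpace.norm_sq_eq]; simp
  have hdet : planeDet n v = ‖v‖ := by
    simp [planeDet, hn]
    field_simp
    rw [hnorm]; ring
  have hn1 : ‖n‖ = 1 := by
    rw [hn, norm_smul, norm_inv, norm_norm]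
    have : ‖(!₂[v 1, -v 0] : Plane)‖ = ‖v‖ := by
      rw [EuclideanSpace.norm_eq, Real.sqrt_eq_iff_eq_sq (by positivity) hvn.le, hnorm]
      simp; ring
    rw [this]
    field_simp
  set ρ : ℝ := r / (2 * ‖v‖) with hρ
  have hρ0 : 0 < ρ := by positivity
  have hρv : ρ * ‖v‖ = r / 2 := by rw [hρ]; field_simp
  have hopen : ∀ y ∈ openSegment ℝ (x - ρ • v) (x + ρ • v), ∃ s : ℝ, |s| * ‖v‖ < r ∧
      y = x + s • v := by
    rintro y ⟨α, β, hα, hβ, hαβ, rfl⟩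
    refine ⟨(β - α) * ρ, ?_, ?_⟩
    · rw [abs_mul, abs_of_pos hρ0, mul_assoc, hρv]
      have : |β - α| ≤ 1 := abs_le.2 ⟨by linarith, by linarith⟩
      nlinarith
    · obtain rfl : α = 1 - β := by linarith
      module
  refine ⟨x - ρ • v, x + ρ • v, n, H (-1), H 1, ?_, ?_, ?_, by rw [hdet]; exact hvn.ne',
    ⟨hn1, ?_, ?_⟩, hconv _, hconv _, hcompl _, hcompl _, ?_⟩
  · intro h
    have : (2 * ρ) • v = 0 := by
      have : (2 * ρ) • v = x + ρ • v - (x - ρ • v) := by module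
      rw [this, h, sub_self]
    rcases smul_eq_zero.1 this with h | h
    · linarith
    · exact hv0 h
  · intro y hy
    obtain ⟨s, hs, rfl⟩ := hopen y hy
    exact hline s hs
  · exact ⟨1 / 2, 1 / 2, by norm_num, by norm_num, by norm_num, by module⟩
  · have : x + ρ • v - (x - ρ • v) = (2 * ρ) • v := by module
    rw [this, inner_smul_right]
    have : inner ℝ n v = 0 := by
      rw [hn, inner_smul_left, PiLp.inner_apply]
      simp [mul_comm]
    rw [this, mul_zero]
  · intro y hy
    obtain ⟨s, hs, rfl⟩ := hopen y hy
    have hmem : x + s • v ∈ Metric.ball x r := by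
      simpa [norm_smul] using hs
    have hnear : ∀ m : Plane, ∀ᶠ t : ℝ in 𝓝[>] 0, x + s • v + t • m ∈ Metric.ball x r := by
      intro m
      have hc : ContinuousAt (fun t : ℝ => x + s • v + t • m) 0 := by fun_prop
      exact (hc.eventually_mem (by simpa using Metric.isOpen_ball.mem_nhds hmem)).filter_mono
        nhdsWithin_le_nhds
    have hval : ∀ t : ℝ, planeDet (x + s • v + t • n - x) v = t * ‖v‖ := by
      intro t
      rw [← hdet]
      simp [planeDet]; ring
    filter_upwards [hnear n, hnear (-n), self_mem_nhdsWithin] with t h1 h2 ht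
    have ht' : 0 < t := ht
    refine ⟨⟨by simpa [sub_eq_add_neg] using h2, ?_⟩, h1, ?_⟩
    · change 0 < -1 * planeDet (x + s • v - t • n - x) v
      have := hval (-t)
      rw [neg_smul, ← sub_eq_add_neg] at this
      rw [this]
      have := mul_pos ht' hvn
      linarith
    · change 0 < 1 * planeDet (x + s • v + t • n - x) v
      rw [hval, one_mul]
      exact mul_pos ht' hvn
  · filter_upwards [Metric.ball_mem_nhds x hr] with y hy
    rcases lt_trichotomy (planeDet (y - x) v) 0 with h | h | h
    · exact Or.inr (Or.inl ⟨hy, show 0 < -1 * planeDet (y - x) v by linarith⟩)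
    · left
      obtain ⟨s, hs⟩ := exists_eq_smul_of_planeDet_eq_zero hv0 h
      obtain rfl : y = x + s • v := by rw [← hs]; abel
      refine subset_frameworkSet p hij (hline s ?_)
      simpa [norm_smul] using hy
    · exact Or.inr (Or.inr ⟨hy, show 0 < 1 * planeDet (y - x) v by linarith⟩)

/-- The distinct points `a`, `b` lie on the segment from `c` to `d`, so `n` is orthogonal to `c -
d`; a zero determinant would make it parallel as well, contradicting `‖n‖ = 1`. -/
theorem planeDet_ne_zero_of_isUnitNormalFromTo {C₁ C₂ : Set Plane} {a b n c d : Plane}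
    (hab : a ≠ b) (h : openSegment ℝ a b ⊆ segment ℝ c d) (hn : IsUnitNormalFromTo C₁ C₂ a b n) :
    planeDet n (c - d) ≠ 0 := by
  have hsub : segment ℝ a b ⊆ segment ℝ c d := by
    rw [← closure_openSegment]
    exact closure_minimal h (isCompact_segment_plane c d).isClosed
  obtain ⟨s, s', -, -, hs, rfl⟩ := hsub (left_mem_segment ℝ a b)
  obtain ⟨t, t', -, -, ht, rfl⟩ := hsub (right_mem_segment ℝ _ b)
  obtain rfl : s' = 1 - s := by linarith
  obtain rfl : t' = 1 - t := by linarith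
  obtain ⟨h1, h2, -⟩ := hn
  have he : t • c + (1 - t) • d - (s • c + (1 - s) • d) = (t - s) • (c - d) := by module
  have hts : t - s ≠ 0 := by
    intro h0
    rw [h0, zero_smul, sub_eq_zero] at he
    exact hab he.symm
  rw [he, inner_smul_right, mul_eq_zero, or_iff_right hts] at h2
  intro h0
  have hcd : c - d ≠ 0 := by
    intro h0
    rw [h0, smul_zero, sub_eq_zero] at he
    exact hab he.symm
  obtain ⟨k, rfl⟩ := exists_eq_smul_of_planeDet_eq_zero hcd h0
  rw [inner_smul_left, real_inner_self_eq_norm_sq] at h2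
  have hk : k = 0 := by simpa [hcd] using h2
  simp [hk] at h1

end

/-! ### Chambers and propagation between neighbours -/

section

variable {V : Type*} {G : SimpleGraph V} {p : V → Plane}

/-- The chamber of a point outside the framework. -/
def chamberAt {x : Plane} (hx : x ∈ (frameworkSet G p)ᶜ) : Chamber G p :=
  ⟨connectedComponentIn (frameworkSet G p)ᶜ x, x, hx, rfl⟩

theorem mem_chamberAt {x : Plane} (hx : x ∈ (frameworkSet G p)ᶜ) : x ∈ (chamberAt hx).1 :=
  mem_connectedComponentIn hx

theorem eq_chamberAt {C : Chamber G p} {x : Plane} (hx : x ∈ (frameworkSet G p)ᶜ)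
    (hxC : x ∈ C.1) : C = chamberAt hx := by
  obtain ⟨C, y, hy, rfl⟩ := C
  exact Subtype.ext (connectedComponentIn_eq hxC)

theorem Chamber.subset_compl (C : Chamber G p) : C.1 ⊆ (frameworkSet G p)ᶜ := by
  obtain ⟨C, y, hy, rfl⟩ := C
  exact connectedComponentIn_subset _ _

theorem Chamber.isPreconnected (C : Chamber G p) : IsPreconnected C.1 := by
  obtain ⟨C, y, hy, rfl⟩ := C
  exact isPreconnected_connectedComponentIn

theorem Chamber.isOpen [Finite V] (C : Chamber G p) : IsOpen C.1 := by
  obtain ⟨C, y, hy, rfl⟩ := C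
  exact (isCompact_frameworkSet G p).isClosed.isOpen_compl.connectedComponentIn

theorem exists_chamber_superset {H : Set Plane} (hH : IsPreconnected H) (hne : H.Nonempty)
    (hHF : H ⊆ (frameworkSet G p)ᶜ) : ∃ C : Chamber G p, H ⊆ C.1 := by
  obtain ⟨x, hx⟩ := hne
  exact ⟨chamberAt (hHF hx), hH.subset_connectedComponentIn hx hHF⟩

theorem IsUnitNormalFromTo.mono {C₁ C₂ D₁ D₂ : Set Plane} {a b n : Plane}
    (h : IsUnitNormalFromTo C₁ C₂ a b n) (h₁ : C₁ ⊆ D₁) (h₂ : C₂ ⊆ D₂) :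
    IsUnitNormalFromTo D₁ D₂ a b n :=
  ⟨h.1, h.2.1, fun x hx => (h.2.2 x hx).mono fun _ ht => ⟨h₁ ht.1, h₂ ht.2⟩⟩

theorem tendsto_add_smul_nhdsGT (x n : Plane) :
    Filter.Tendsto (fun t : ℝ => x + t • n) (𝓝[>] 0) (𝓝 x) := by
  have hc : ContinuousAt (fun t : ℝ => x + t • n) 0 := by fun_prop
  simpa using hc.tendsto.mono_left (nhdsWithin_le_nhds (s := Set.Ioi 0))

theorem IsUnitNormalFromTo.subset_closure {C₁ C₂ : Set Plane} {a b n : Plane}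
    (h : IsUnitNormalFromTo C₁ C₂ a b n) : openSegment ℝ a b ⊆ closure C₁ ∩ closure C₂ := by
  intro x hx
  refine ⟨mem_closure_of_tendsto (tendsto_add_smul_nhdsGT x (-n)) ?_,
    mem_closure_of_tendsto (tendsto_add_smul_nhdsGT x n) ((h.2.2 x hx).mono fun _ ht => ht.2)⟩
  filter_upwards [h.2.2 x hx] with t ht
  simpa [sub_eq_add_neg] using ht.1

variable [Fintype V]

/-- A function on the chambers that takes equal values on neighbours is constant near each
non-singular point of the plane. -/
theorem eventually_eq_of_neighbours {α : Type*} (hp : Function.Injective p)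
    (f : Chamber G p → α)
    (hf : ∀ (C₁ C₂ : Chamber G p) (i j : V) (a b n : Plane), NeighboursAlong G p C₁ C₂ i j a b →
      IsUnitNormalFromTo C₁.1 C₂.1 a b n → f C₁ = f C₂) {x : Plane}
    (hx : x ∉ singularSet G p) :
    ∃ c, (∀ᶠ y in 𝓝 x, ∀ hy : y ∈ (frameworkSet G p)ᶜ, f (chamberAt hy) = c) ∧
      ∃ᶠ y in 𝓝 x, y ∈ (frameworkSet G p)ᶜ := by
  by_cases hxF : x ∈ (frameworkSet G p)ᶜ
  · refine ⟨f (chamberAt hxF), ?_, ?_⟩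
    · filter_upwards [(chamberAt hxF).isOpen.mem_nhds (mem_chamberAt hxF)] with y hy hyF
      rw [← eq_chamberAt hyF hy]
    · exact Filter.Eventually.frequently
        ((isCompact_frameworkSet G p).isClosed.isOpen_compl.mem_nhds hxF)
  · rw [Set.notMem_compl_iff] at hxF
    rcases hxF with ⟨k, rfl⟩ | hxF
    · exact (hx (Or.inl ⟨k, rfl⟩)).elim
    simp only [Set.mem_iUnion] at hxF
    obtain ⟨i, j, hij, hxij⟩ := hxF
    obtain ⟨a, b, n, H₁, H₂, hab, hsub, hxab, -, hn, hc₁, hc₂, hF₁, hF₂, hev⟩ :=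
      exists_sides hp hij hxij hx
    obtain ⟨t, ht₁, ht₂⟩ := (hn.2.2 x hxab).exists
    obtain ⟨C₁, hC₁⟩ := exists_chamber_superset hc₁.isPreconnected ⟨_, ht₁⟩ hF₁
    obtain ⟨C₂, hC₂⟩ := exists_chamber_superset hc₂.isPreconnected ⟨_, ht₂⟩ hF₂
    have hn' := hn.mono hC₁ hC₂
    have heq : f C₁ = f C₂ := by
      -- Both sides of an edge may belong to the same chamber, which the neighbour relation
      -- excludes.
      by_cases h : C₁ = C₂
      · rw [h]
      · exact hf C₁ C₂ i j a b n ⟨h, hij, hab, hsub, hn'.subset_closure⟩ hn'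
    refine ⟨f C₁, ?_, ?_⟩
    · filter_upwards [hev] with y hy hyF
      rcases hy with hy | hy | hy
      · exact (hyF hy).elim
      · rw [← eq_chamberAt hyF (hC₁ hy)]
      · rw [← eq_chamberAt hyF (hC₂ hy), heq]
    · exact (tendsto_add_smul_nhdsGT x n).frequently
        ((hn.2.2 x hxab).mono fun _ ht => hF₂ ht.2).frequently

theorem one_lt_rank_plane : 1 < Module.rank ℝ Plane := by
  rw [rank_eq_card_basis (EuclideanSpace.basisFun (Fin 2) ℝ).toBasis]
  simp

/-- A ray outside a disc containing the framework is connected, hence lies in one chamber. -/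
theorem exists_unbounded_chamber (G : SimpleGraph V) (p : V → Plane) :
    ∃ C : Chamber G p, ¬ Bornology.IsBounded C.1 := by
  obtain ⟨R, hR⟩ := (isCompact_frameworkSet G p).isBounded.subset_ball 0
  set u : Plane := EuclideanSpace.single 0 1 with hu
  have hun : ‖u‖ = 1 := by simp [hu]
  set H : Set Plane := (fun t : ℝ => t • u) '' Set.Ici (max R 0) with hH
  have hHF : H ⊆ (frameworkSet G p)ᶜ := by
    rintro _ ⟨t, ht, rfl⟩ hF
    have h1 := hR hF
    rw [mem_ball_zero_iff, norm_smul, hun, mul_one] at h1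
    exact absurd ((le_max_left R 0).trans ht) (not_le.2 ((le_abs_self t).trans_lt h1))
  obtain ⟨C, hC⟩ := exists_chamber_superset (isPreconnected_Ici.image _
    (by fun_prop)) ⟨_, Set.mem_image_of_mem _ Set.self_mem_Ici⟩ hHF
  refine ⟨C, fun hb => ?_⟩
  obtain ⟨M, hM⟩ := (hb.subset hC).subset_ball 0
  have := hM (Set.mem_image_of_mem (fun t : ℝ => t • u)
    (Set.mem_Ici.2 (le_max_left (max R 0) M)))
  rw [mem_ball_zero_iff, norm_smul, hun, mul_one] at this
  exact absurd (le_max_right (max R 0) M) (not_le.2 ((le_abs_self _).trans_lt this))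

/-- A function on the chambers that takes equal values on neighbours and the value `c` on the
unbounded chamber is constant: the plane without the finitely many singular points is connected. -/
theorem eq_of_neighbours {α : Type*} (hp : Function.Injective p) (hov : NoOverlappingEdges G p)
    (f : Chamber G p → α) (c : α)
    (hf : ∀ (C₁ C₂ : Chamber G p) (i j : V) (a b n : Plane), NeighboursAlong G p C₁ C₂ i j a b →
      IsUnitNormalFromTo C₁.1 C₂.1 a b n → f C₁ = f C₂)
    (hc : ∀ C : Chamber G p, ¬ Bornology.IsBounded C.1 → f C = c) (C : Chamber G p) : f C = c := by
  set S := singularSet G p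
  have hconn : IsPreconnected Sᶜ :=
    ((finite_singularSet hov).countable.isConnected_compl_of_one_lt_rank
      one_lt_rank_plane).isPreconnected
  set P : α → Plane → Prop := fun d x =>
    ∀ᶠ y in 𝓝 x, ∀ hy : y ∈ (frameworkSet G p)ᶜ, f (chamberAt hy) = d
  have hPopen : ∀ d, IsOpen {x | P d x} := fun d => isOpen_setOfPred_eventually_nhds
  have hmem : ∀ (D : Chamber G p) {x : Plane}, x ∈ D.1 → x ∈ Sᶜ ∩ {x | P (f D) x} := by
    intro D x hx
    refine ⟨?_, ?_⟩
    · have hxF := D.subset_compl hx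
      rintro (⟨k, rfl⟩ | h)
      · exact hxF (vertex_mem_frameworkSet G p k)
      · simp only [Set.mem_iUnion] at h
        obtain ⟨i, j, k, l, ⟨hij, -⟩, h, -⟩ := h
        exact hxF (subset_frameworkSet p hij h)
    · change P _ _
      filter_upwards [D.isOpen.mem_nhds hx] with y hy hyF
      rw [← eq_chamberAt hyF hy]
  have hnonempty : ∀ D : Chamber G p, ∃ x, x ∈ D.1 := by
    rintro ⟨D, x, hx, rfl⟩
    exact ⟨x, mem_connectedComponentIn hx⟩
  obtain ⟨D, hD⟩ := exists_unbounded_chamber G p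
  obtain ⟨x, hx⟩ := hnonempty C
  obtain ⟨y, hy⟩ := hnonempty D
  by_contra hne
  -- If `f C ≠ c`, the points with local value `c` and those with another local value form two open
  -- sets that cover the connected set `Sᶜ` and both meet it, so they share a point `z` of it.
  obtain ⟨z, hzS, hzc, hzne⟩ := hconn {x | P c x} (⋃ d ∈ {d | d ≠ c}, {x | P d x}) (hPopen c)
    (isOpen_biUnion fun d _ => hPopen d)
    (fun z hz => by
      obtain ⟨d, hd, -⟩ := eventually_eq_of_neighbours hp f hf hz
      by_cases hdc : d = c
      · exact Or.inl (hdc ▸ hd)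
      · exact Or.inr (Set.mem_biUnion (show d ∈ {d | d ≠ c} from hdc) hd))
    ⟨y, hc D hD ▸ hmem D hy⟩
    ⟨x, (hmem C hx).1, Set.mem_biUnion (show f C ∈ {d | d ≠ c} from hne) (hmem C hx).2⟩
  simp only [Set.mem_iUnion] at hzne
  obtain ⟨d, hdc, hzd⟩ := hzne
  -- `P` would hold vacuously without points off the framework near `z`; such a point gives the
  -- contradiction.
  obtain ⟨-, -, hfreq⟩ := eventually_eq_of_neighbours hp f hf hzS
  obtain ⟨w, hw, hwc, hwd⟩ := (hfreq.and_eventually (hzc.and hzd)).exists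
  exact hdc ((hwd hw).symm.trans (hwc hw))

/-! ### The lifting of a stress, its uniqueness and the linear bijection -/

/-- The values of the potential of a stress on the chambers. -/
noncomputable def stressLifting (ω : V → V → ℝ) (C : Chamber G p) : ConstForm :=
  stressPotential ω p C.2.choose

theorem stressLifting_eq {ω : V → V → ℝ} (hω : ω ∈ selfStresses G p) {C : Chamber G p} {x : Plane}
    (hx : x ∈ C.1) : stressLifting ω C = stressPotential ω p x := by
  refine stressPotential_eq_of_isPreconnected hω C.isOpen C.isPreconnected C.subset_compl ?_ hx
  have h := C.2.choose_spec
  exact (congrArg (C.2.choose ∈ ·) h.2).mpr (mem_connectedComponentIn h.1)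

/-- The difference of the values of the lifting on the two sides of a non-singular point of an
edge. -/
theorem stressLifting_sub {ω : V → V → ℝ} (hω : ω ∈ selfStresses G p) {C₁ C₂ : Chamber G p}
    {i j : V} (hij : G.Adj i j) {x n : Plane} (hx : x ∈ segment ℝ (p i) (p j))
    (hxS : x ∉ singularSet G p) (hn : planeDet n (p i - p j) ≠ 0)
    (hev : ∀ᶠ t : ℝ in 𝓝[>] 0, x - t • n ∈ C₁.1 ∧ x + t • n ∈ C₂.1) :
    stressLifting ω C₂ - stressLifting ω C₁ =
      (Real.sign (planeDet n (p i - p j)) * ω i j) • dForm (p i - p j) := by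
  refine tendsto_nhds_unique_of_eventuallyEq tendsto_const_nhds
    (tendsto_stressPotential_sub hω hij hx hxS hn) ?_
  filter_upwards [hev] with t ht
  rw [stressLifting_eq hω ht.1, stressLifting_eq hω ht.2]

theorem isDifferentialLifting_stressLifting (hov : NoOverlappingEdges G p) {ω : V → V → ℝ}
    (hω : ω ∈ selfStresses G p) : IsDifferentialLifting G p ω (stressLifting ω) := by
  refine ⟨fun C₁ C₂ i j a b n h hn => ?_, fun C hC => ?_⟩
  · obtain ⟨-, hij, hab, hsub, -⟩ := h
    -- An infinite sub-segment has a point outside the finite singular set, and the jump at that one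
    -- point suffices.
    have hinf : (openSegment ℝ a b).Infinite := by
      rw [openSegment_eq_image_lineMap]
      exact (Set.Ioo_infinite one_pos).image (AffineMap.lineMap_injective ℝ hab).injOn
    obtain ⟨x, hx, hxS⟩ := (hinf.sdiff (finite_singularSet hov)).nonempty
    exact stressLifting_sub hω hij (hsub hx) hxS
      (planeDet_ne_zero_of_isUnitNormalFromTo hab hsub hn) (hn.2.2 x hx)
  -- An unbounded chamber contains points tending to infinity, so its constant value is the limit 0
  -- of the potential.
  · have hne : (Bornology.cobounded Plane ⊓ Filter.principal C.1).NeBot := by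
      rw [Filter.inf_principal_neBot_iff]
      intro U hU
      by_contra hU'
      rw [Set.not_nonempty_iff_eq_empty, ← Set.disjoint_iff_inter_eq_empty] at hU'
      exact hC (Bornology.isBounded_def.2
        (Filter.mem_of_superset hU hU'.subset_compl_right))
    have h := (tendsto_stressPotential_cobounded ω p).mono_left
      (inf_le_left (b := Filter.principal C.1))
    refine tendsto_nhds_unique_of_eventuallyEq tendsto_const_nhds h ?_
    filter_upwards [Filter.mem_inf_of_right (Filter.mem_principal_self C.1)] with x hx
    rw [stressLifting_eq hω hx]

theorem IsDifferentialLifting.unique (hp : Function.Injective p) (hov : NoOverlappingEdges G p)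
    {ω : V → V → ℝ} {l m : Chamber G p → ConstForm} (hl : IsDifferentialLifting G p ω l)
    (hm : IsDifferentialLifting G p ω m) : l = m := by
  funext C
  rw [← sub_eq_zero]
  refine eq_of_neighbours hp hov (fun C => l C - m C) 0 (fun C₁ C₂ i j a b n h hn => ?_)
    (fun C hC => by rw [hl.2 C hC, hm.2 C hC, sub_zero]) C
  have := (hl.1 C₁ C₂ i j a b n h hn).trans (hm.1 C₁ C₂ i j a b n h hn).symm
  rw [sub_eq_sub_iff_add_eq_add] at this ⊢
  rw [add_comm, ← this, add_comm]

/-- The jump formula `stressLifting_sub` does not require different chambers, so it also forces zero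
stress on edges with the same chamber on both sides. -/
theorem eq_zero_of_stressLifting_eq_zero (hp : Function.Injective p)
    (hov : NoOverlappingEdges G p) {ω : V → V → ℝ} (hω : ω ∈ selfStresses G p)
    (h : ∀ C : Chamber G p, stressLifting ω C = 0) : ω = 0 := by
  funext i j
  by_cases hij : G.Adj i j
  swap
  · exact hω.2.1 i j hij
  have hpij : p i ≠ p j := hp.ne hij.ne
  have hinf : (segment ℝ (p i) (p j)).Infinite := by
    rw [segment_eq_image_lineMap]
    exact (Set.Icc_infinite one_pos).image (AffineMap.lineMap_injective ℝ hpij).injOn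
  obtain ⟨x, hx, hxS⟩ := (hinf.sdiff (finite_singularSet hov)).nonempty
  obtain ⟨a, b, n, H₁, H₂, -, -, hxab, hdet, hn, hc₁, hc₂, hF₁, hF₂, -⟩ :=
    exists_sides hp hij hx hxS
  obtain ⟨t, ht₁, ht₂⟩ := (hn.2.2 x hxab).exists
  obtain ⟨C₁, hC₁⟩ := exists_chamber_superset hc₁.isPreconnected ⟨_, ht₁⟩ hF₁
  obtain ⟨C₂, hC₂⟩ := exists_chamber_superset hc₂.isPreconnected ⟨_, ht₂⟩ hF₂
  have key := stressLifting_sub hω hij hx hxS hdet ((hn.mono hC₁ hC₂).2.2 x hxab)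
  rw [h, h, sub_zero] at key
  -- On `p i - p j` the form takes the squared edge length, which is nonzero.
  have := congrArg (fun φ : ConstForm => φ (p i - p j)) key
  simp only [zero_apply, smul_apply, smul_eq_mul, zero_eq_mul, mul_eq_zero,
    Real.sign_eq_zero_iff] at this
  rcases this with (h0 | h0) | h0
  · exact (hdet h0).elim
  · exact h0
  · exact (dForm_self_ne_zero (sub_ne_zero.2 hpij) h0).elim

/-- The linear map that sends a self-stress to its differential lifting. -/
noncomputable def liftingMap (hov : NoOverlappingEdges G p) :
    selfStresses G p →ₗ[ℝ] differentialLiftings G p where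
  toFun ω := ⟨stressLifting ω, ω, ω.2, isDifferentialLifting_stressLifting hov ω.2⟩
  map_add' _ _ := Subtype.ext (funext fun _ => stressPotential_add _ _ _ _)
  map_smul' _ _ := Subtype.ext (funext fun _ => stressPotential_smul _ _ _ _)

theorem bijective_liftingMap (hp : Function.Injective p) (hov : NoOverlappingEdges G p) :
    Function.Bijective (liftingMap (G := G) hov) := by
  refine ⟨?_, ?_⟩
  · rw [injective_iff_map_eq_zero]
    intro ω h
    exact Subtype.ext (eq_zero_of_stressLifting_eq_zero hp hov ω.2
      fun C => congrFun (congrArg Subtype.val h) C)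
  · rintro ⟨l, ω, hω, hl⟩
    exact ⟨⟨ω, hω⟩, Subtype.ext ((isDifferentialLifting_stressLifting hov hω).unique hp hov hl)⟩

end

theorem theorem2 {V : Type*} [Fintype V] (G : SimpleGraph V) (p : V → Plane)
    (hp : Function.Injective p) (hov : NoOverlappingEdges G p) :
    ∃ Φ : selfStresses G p ≃ₗ[ℝ] differentialLiftings G p,
      ∀ (ω : selfStresses G p) (l : Chamber G p → ConstForm),
        IsDifferentialLifting G p (ω : V → V → ℝ) l ↔
          l = (Φ ω : Chamber G p → ConstForm) := by
  refine ⟨LinearEquiv.ofBijective (liftingMap hov) (bijective_liftingMap hp hov), fun ω l => ?_⟩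
  have h := isDifferentialLifting_stressLifting hov ω.2
  exact ⟨fun hl => hl.unique hp hov h, fun hl => hl ▸ h⟩
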